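/- **Notation.** Let $X$ be a reflexive real Banach space with topological dual $X^*$ and pairing $\langle\cdot,\cdot\rangle$; the dual of $\mathbb{R}$ is identified with $\mathbb{R}$. For $h\colon X\to[-\infty,+\infty]$, $\operatorname{dom}h=\{x\mid h(x)<+\infty\}$; $h$ is proper if it never takes the value $-\infty$ and is not identically $+\infty$; $\Gamma_0(X)$ is the set of proper lower semicontinuous convex functions $X\to\,]-\infty,+\infty]$; $\operatorname{Argmin}h=\{x\in\operatorname{dom}h\mid h(x)\le h(y)\ \forall y\}$; $h^*(x^*)=\sup_{x\in X}(\langle x,x^*\rangle-h(x))$; and $$\partial h(x)=\{x^*\in X^*\mid \langle y-x,x^*\rangle+h(x)\le h(y)\ \ \forall y\in\operatorname{dom}h\}.$$ $\iota_C$ is the function equal to $0$ on $C$ and $+\infty$ elsewhere. The recession function of a proper $h$ is $(\operatorname{rec}h)(y)=\sup_{x\in\operatorname{dom}h}(h(x+y)-h(x))$ and its perspective is $$\widetilde h(x,\xi)=\begin{cases}\xi h(x/\xi),&\xi>0;\\ (\operatorname{rec}h)(x),&\xi=0;\\ +\infty,&\xi<0.\end{cases}$$ (The same notation is used on $X^*$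 and on $\mathbb{R}$.) For a proper $f\colon X\to\,]-\infty,+\infty]$, let $\xi\diamond f=\iota_{\overline{\operatorname{dom}}f}$ if $\xi=0$ and $\xi\diamond f=\xi f$ if $\xi>0$; for definiteness $\xi\diamond f=\xi f$ (with $\xi\cdot(+\infty)=-\infty$) also if $\xi<0$. **Proposition 2.8.** Let $\phi\in\Gamma_0(\mathbb{R})$ be nonconstant and increasing (that is, $\xi\le\eta\Rightarrow\phi(\xi)\le\phi(\eta)$), and let $f\in\Gamma_0(X)$ be such that $(\operatorname{dom}\phi)\cap f(\operatorname{dom}f)\ne\varnothing$. Let $(\phi\circ f)(x)=\phi(f(x))$ if $f(x)\in\operatorname{dom}\phi$, and $(\phi\circ f)(x)=+\infty$ otherwise. Then: 1. $\operatorname{dom}(\phi\circ f)=f^{-1}(\operatorname{dom}\phi)$. 2. $\phi\circ f\in\Gamma_0(X)$. 3. If there is $z\in X$ with $f(z)\in\operatorname{int}\operatorname{dom}\phi$, then for every $x^*\in X^*$ $$(\phi\circ f)^*(x^*)=\min_{\xi^*\in\mathbb{R}}\big(\phi^*(\xi^*)+\widetilde{f^*}(x^*,\xi^*)\big),$$ the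 minimum being attained. 4. For every $x\in\operatorname{dom}f$, $\ \bigcup_{\xi^*\in\partial\phi(f(x))}\partial(\xi^*\diamond f)(x)\subset\partial(\phi\circ f)(x)$. Suppose in addition that there is $z\in\operatorname{dom}f$ with $f(z)\in\operatorname{int}\operatorname{dom}\phi$, and let $x\in\operatorname{dom}f$, $x^*\in X^*$ and $\xi^*\in\mathbb{R}$. Then: 5. $\partial(\phi\circ f)(x)=\bigcup_{\eta^*\in\partial\phi(f(x))}\partial(\eta^*\diamond f)(x)$. 6. The following are equivalent: (a) $(\phi\circ f)(x)+\phi^*(\xi^*)=(\xi^*\diamond f)(x)$ and $(\xi^*\diamond f)(x)+(\xi^*\diamond f)^*(x^*)=\langle x,x^*\rangle$; (b) $(\phi\circ f)(x)+\phi^*(\xi^*)+(\xi^*\diamond f)^*(x^*)=\langle x,x^*\rangle$; (c) $(\phi\circ f)(x)+(\phi\circ f)^*(x^*)=\langle x,x^*\rangle$ and $\phi^*(\xi^*)+(\xi^*\diamond f)^*(x^*)=(\phi\circ f)^*(x^*)$. 7. One has $\xi^*\in\partial\phi(f(x))$ and $x^*\in\partial(\xi^*\diamond f)(x)$ if and only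 if $x^*\in\partial(\phi\circ f)(x)$ and $\xi^*\in\operatorname{Argmin}\big(\phi^*+\widetilde{f^*}(x^*,\cdot)\big)$. -/

import Mathlib

namespace NonlinComp

noncomputable section

/-- A real normed space is reflexive if the canonical isometry into its bidual is onto. -/
def IsReflexive (X : Type*) [NormedAddCommGroup X] [NormedSpace ℝ X] : Prop :=
  Function.Surjective (NormedSpace.inclusionInDoubleDual ℝ X)

/-- The domain `{x | f x < +∞}`. -/
def dom {X : Type*} (f : X → EReal) : Set X := {x | f x < ⊤}

/-- `f` is proper: it never takes the value `-∞` and is not identically `+∞`. -/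
def IsProper {X : Type*} (f : X → EReal) : Prop :=
  (∀ x, f x ≠ ⊥) ∧ ∃ x, f x ≠ ⊤

/-- The epigraph of `f`, a subset of `X × ℝ`. -/
def epigraph {X : Type*} (f : X → EReal) : Set (X × ℝ) := {p | f p.1 ≤ (p.2 : EReal)}

/-- `f ∈ Γ₀(X)`: proper, lower semicontinuous (in the norm topology) and convex. -/
structure IsGammaZero {X : Type*} [NormedAddCommGroup X] [NormedSpace ℝ X]
    (f : X → EReal) : Prop where
  proper : IsProper f
  lsc : LowerSemicontinuous f
  convex : Convex ℝ (epigraph f)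

open Classical in
/-- The indicator function of `C` in the sense of convex analysis. -/
def indicator {X : Type*} (C : Set X) (x : X) : EReal := if x ∈ C then 0 else ⊤

/-- The set of minimizers of `f`; they are required to lie in the domain of `f`. -/
def argmin {X : Type*} (f : X → EReal) : Set X := {x | x ∈ dom f ∧ ∀ y, f x ≤ f y}

/-- The conjugate `f* : x* ↦ sup_x (⟨x, x*⟩ - f x)`, on the topological dual. -/
def conjugate {X : Type*} [NormedAddCommGroup X] [NormedSpace ℝ X]
    (f : X → EReal) (xs : StrongDual ℝ X) : EReal :=
  ⨆ x : X, ((xs x : ℝ) : EReal) - f x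

/-- The subdifferential of `f` at `x`. -/
def subdifferential {X : Type*} [NormedAddCommGroup X] [NormedSpace ℝ X]
    (f : X → EReal) (x : X) : Set (StrongDual ℝ X) :=
  {xs | ∀ y ∈ dom f, ((xs (y - x) : ℝ) : EReal) + f x ≤ f y}

/-- The identification of `ℝ` with its dual: `ξs` is the functional `ξ ↦ ξs * ξ`. -/
def realFunctional (ξs : ℝ) : StrongDual ℝ ℝ := ξs • ContinuousLinearMap.id ℝ ℝ

/-- The conjugate of a function on the real line, as a function on the real line. -/
def conjugateReal (φ : ℝ → EReal) (ξs : ℝ) : EReal := conjugate φ (realFunctional ξs)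

/-- The subdifferential of a function on the real line, as a set of real numbers. -/
def subdifferentialReal (φ : ℝ → EReal) (ξ : ℝ) : Set ℝ :=
  {ξs | realFunctional ξs ∈ subdifferential φ ξ}

/-- The recession function `y ↦ sup_{x ∈ dom f} (f (x + y) - f x)`. -/
def recession {X : Type*} [NormedAddCommGroup X] [NormedSpace ℝ X]
    (f : X → EReal) (y : X) : EReal :=
  ⨆ x ∈ dom f, f (x + y) - f x

/-- The perspective of `f`. -/
def perspective {X : Type*} [NormedAddCommGroup X] [NormedSpace ℝ X]
    (f : X → EReal) (p : X × ℝ) : EReal :=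
  if 0 < p.2 then (p.2 : EReal) * f (p.2⁻¹ • p.1)
  else if p.2 = 0 then recession f p.1
  else ⊤

/-- The scaling `ξ ⋄ f`: it is the indicator of the closure of `dom f` if `ξ = 0`, and `ξ f` if
`ξ > 0`. For definiteness, the formula `ξ f` is also used for `ξ < 0`. -/
def scaling {X : Type*} [NormedAddCommGroup X] [NormedSpace ℝ X]
    (ξ : ℝ) (f : X → EReal) (x : X) : EReal :=
  if ξ = 0 then indicator (closure (dom f)) x else (ξ : EReal) * f x

/-- A set of real numbers, regarded as a set of extended real numbers. -/
def toERealSet (S : Set ℝ) : Set EReal := (fun r : ℝ => (r : EReal)) '' S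

open Classical in
/-- The composition `φ ∘ f`: its value at `x` is `φ (f x)` if `f x` is a real number in `dom φ`,
and `+∞` otherwise. -/
def composition {X : Type*} (φ : ℝ → EReal) (f : X → EReal) (x : X) : EReal :=
  if f x ∈ toERealSet (dom φ) then φ (f x).toReal else ⊤

end

end NonlinComp

namespace NonlinComp

open Set Filter Topology

/-! The core is Lagrangian duality with a scalar multiplier. For fixed `xs`, the value function v(s)
= inf_x (φ(f x + s) - ⟨x, xs⟩) is convex, because φ is convex and increasing and f is convex, and
v(0) = -(φ∘f)*(xs). If some f z is interior to dom φ, v is below +∞ near 0, so when v(0) is finite v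
has an affine minorant ξ s + v(0) (`exists_multiplier`). Taking suprema separately over the argument
of φ and over x gives φ*(ξ) + (ξ⋄f)*(xs) ≤ (φ∘f)*(xs); the reverse inequality holds for every ξ ≥ 0.
Negative ξ are excluded because φ* = +∞ there.

Moreover (ξ⋄f)* is the perspective of f* (`perspective_conjugate`); at ξ = 0 this says that rec f*
is the support function of dom f. The subdifferential statements are equality cases of
Fenchel-Young: the inequalities for φ and for ξ⋄f add up to the one for φ∘f, so equality in the sum
forces equality in each. Attainment of the minimum supplies the multiplier for the reverse
inclusion.

Extended-real relations are mostly tested against real upper bounds, so that no ∞ - ∞ occurs. -/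

theorem eq_of_forall_le_coe_iff {A B : EReal} (h : ∀ c : ℝ, A ≤ c ↔ B ≤ c) : A = B :=
  le_antisymm (EReal.le_of_forall_lt_iff_le.1 fun z hz => (h z).2 hz.le)
    (EReal.le_of_forall_lt_iff_le.1 fun z hz => (h z).1 hz.le)

theorem exists_coe_eq {a : EReal} (h₁ : a ≠ ⊥) (h₂ : a ≠ ⊤) : ∃ r : ℝ, a = r :=
  ⟨a.toReal, (EReal.coe_toReal h₂ h₁).symm⟩

theorem top_add_ne_coe (a : EReal) (r : ℝ) : ⊤ + a ≠ r := by
  by_cases ha : a = ⊥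
  · simp [ha]
  · rw [EReal.top_add_of_ne_bot ha]
    exact EReal.top_ne_coe r

theorem IsProper.exists_coe {α : Type*} {h : α → EReal} (hh : IsProper h) :
    ∃ x, ∃ r : ℝ, h x = r := by
  obtain ⟨x, hx⟩ := hh.2
  exact ⟨x, exists_coe_eq (hh.1 x) hx⟩

/-! ### Conjugates, Fenchel-Young and the recession function of a conjugate -/

section

variable {X : Type*} [NormedAddCommGroup X] [NormedSpace ℝ X]

/-- Jensen's inequality for a convex epigraph, in terms of real upper bounds. -/
theorem le_combination_of_convex_epigraph {h : X → EReal} (hh : Convex ℝ (epigraph h))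
    {x y : X} {p q a b : ℝ} (hx : h x ≤ p) (hy : h y ≤ q) (ha : 0 ≤ a) (hb : 0 ≤ b)
    (hab : a + b = 1) : h (a • x + b • y) ≤ ((a * p + b * q : ℝ) : EReal) :=
  hh (show (x, p) ∈ epigraph h from hx) (show (y, q) ∈ epigraph h from hy) ha hb hab

theorem conjugate_le_coe_iff {h : X → EReal} (hbot : ∀ x, h x ≠ ⊥) (xs : StrongDual ℝ X) (c : ℝ) :
    conjugate h xs ≤ c ↔ ∀ x, ∀ a : ℝ, h x = a → xs x - a ≤ c := by
  rw [conjugate, iSup_le_iff]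
  refine forall_congr' fun x => ⟨fun hx a ha => ?_, fun hx => ?_⟩
  · rw [ha] at hx
    exact_mod_cast hx
  · by_cases htop : h x = ⊤
    · simp [htop]
    · obtain ⟨a, ha⟩ := exists_coe_eq (hbot x) htop
      rw [ha]
      exact_mod_cast hx a ha

theorem conjugate_ne_bot {h : X → EReal} (hh : IsProper h) (xs : StrongDual ℝ X) :
    conjugate h xs ≠ ⊥ := by
  obtain ⟨x, a, ha⟩ := hh.exists_coe
  intro hbot
  have := (conjugate_le_coe_iff hh.1 xs (xs x - a - 1)).1 (by simp [hbot]) x a ha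
  linarith

/-- The Fenchel-Young characterization of subgradients. -/
theorem mem_subdifferential_iff {h : X → EReal} (hh : IsProper h) (x : X) (xs : StrongDual ℝ X) :
    xs ∈ subdifferential h x ↔ h x + conjugate h xs = ((xs x : ℝ) : EReal) := by
  by_cases htop : h x = ⊤
  · rw [htop, EReal.top_add_of_ne_bot (conjugate_ne_bot hh xs)]
    refine iff_of_false (fun hmem => ?_) (EReal.top_ne_coe _)
    obtain ⟨y, b, hb⟩ := hh.exists_coe
    have := hmem y (by simp [dom, hb])
    rw [htop, hb, EReal.coe_add_top, top_le_iff] at this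
    exact EReal.coe_ne_top _ this
  · obtain ⟨a, ha⟩ := exists_coe_eq (hh.1 x) htop
    have key : xs ∈ subdifferential h x ↔ conjugate h xs ≤ ((xs x - a : ℝ) : EReal) := by
      rw [conjugate_le_coe_iff hh.1]
      constructor
      · intro hmem y b hb
        have := hmem y (by simp [dom, hb])
        rw [ha, hb] at this
        have h2 : xs (y - x) + a ≤ b := by exact_mod_cast this
        rw [map_sub] at h2
        linarith
      · intro hle y hy
        obtain ⟨b, hb⟩ := exists_coe_eq (hh.1 y) (ne_of_lt hy)
        have := hle y b hb
        rw [ha, hb]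
        have h2 : xs (y - x) + a ≤ b := by
          rw [map_sub]
          linarith
        exact_mod_cast h2
    rw [key, ha]
    constructor
    · intro hle
      obtain ⟨c, hc⟩ := exists_coe_eq (conjugate_ne_bot hh xs)
        (ne_top_of_le_ne_top (EReal.coe_ne_top _) hle)
      have hge := (conjugate_le_coe_iff hh.1 xs c).1 hc.le x a ha
      rw [hc] at hle ⊢
      have hle' : c ≤ xs x - a := by exact_mod_cast hle
      have : a + c = xs x := by linarith
      exact_mod_cast this
    · intro heq
      have hct : conjugate h xs ≠ ⊤ := by
        intro hc
        rw [hc, EReal.coe_add_top] at heq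
        exact EReal.top_ne_coe _ heq
      obtain ⟨c, hc⟩ := exists_coe_eq (conjugate_ne_bot hh xs) hct
      rw [hc] at heq ⊢
      have heq' : a + c = xs x := by exact_mod_cast heq
      have : c ≤ xs x - a := by linarith
      exact_mod_cast this

/-- A function in `Γ₀(X)` has a continuous affine minorant. -/
theorem IsGammaZero.exists_conjugate_eq_coe {f : X → EReal} (hf : IsGammaZero f) :
    ∃ xs : StrongDual ℝ X, ∃ c : ℝ, conjugate f xs = c := by
  obtain ⟨x₀, r₀, hx₀⟩ := hf.proper.exists_coe
  have hclosed : IsClosed (epigraph f) :=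
    hf.lsc.isClosed_epigraph.preimage
      (continuous_fst.prodMk (continuous_coe_real_ereal.comp continuous_snd))
  have hnot : (x₀, r₀ - 1) ∉ epigraph f := by
    intro h
    have h' : f x₀ ≤ ((r₀ - 1 : ℝ) : EReal) := h
    rw [hx₀] at h'
    have : r₀ ≤ r₀ - 1 := by exact_mod_cast h'
    linarith
  obtain ⟨g, u, hu, hg⟩ := geometric_hahn_banach_point_closed hf.convex hclosed hnot
  have hsplit : ∀ (x : X) (r : ℝ), g (x, r) = g (x, 0) + r * g (0, 1) := by
    intro x r
    have : (x, r) = (x, (0 : ℝ)) + r • ((0 : X), (1 : ℝ)) := by simp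
    conv_lhs => rw [this]
    rw [map_add, map_smul, smul_eq_mul]
  -- The separated point lies directly below a point of the epigraph, so the hyperplane cannot be
  -- vertical.
  have hpos : 0 < g (0, 1) := by
    have h1 := hg (x₀, r₀) (show f x₀ ≤ _ from hx₀.le)
    rw [hsplit] at hu h1
    linarith
  set c := g (0, 1) with hc
  set ys : StrongDual ℝ X := -(c⁻¹ • g.comp (ContinuousLinearMap.inl ℝ X ℝ)) with hys
  have hle : conjugate f ys ≤ ((-(u / c) : ℝ) : EReal) := by
    rw [conjugate_le_coe_iff hf.proper.1]
    intro x a ha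
    have h1 := hg (x, a) (show f x ≤ _ from ha.le)
    rw [hsplit] at h1
    have hval : ys x = -(c⁻¹ * g (x, 0)) := by simp [hys]
    rw [hval]
    have : u / c < c⁻¹ * g (x, 0) + a := by
      rw [div_lt_iff₀ hpos]
      field_simp
      linarith
    linarith
  exact ⟨ys, exists_coe_eq (conjugate_ne_bot hf.proper ys)
    (ne_top_of_le_ne_top (EReal.coe_ne_top _) hle)⟩

/-- The recession function of the conjugate is the support function of the domain. -/
theorem recession_conjugate_le_coe_iff {f : X → EReal} (hf : IsGammaZero f)
    (ys : StrongDual ℝ X) (c : ℝ) :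
    recession (conjugate f) ys ≤ c ↔ ∀ x, ∀ a : ℝ, f x = a → ys x ≤ c := by
  have hle := fun xs k => conjugate_le_coe_iff hf.proper.1 xs k
  rw [recession, iSup₂_le_iff]
  constructor
  · intro hrec x a ha
    obtain ⟨us, k, hk⟩ := hf.exists_conjugate_eq_coe
    -- Iterating the recession bound from `us` makes f* grow at most at rate c along `ys`. A value
    -- ys x > c would force faster growth, which a large n detects.
    have hind : ∀ n : ℕ, conjugate f (us + (n : ℝ) • ys) ≤ ((k + n * c : ℝ) : EReal) := by
      intro n
      induction n with
      | zero => simp [hk]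
      | succ n ih =>
        obtain ⟨r, hr⟩ := exists_coe_eq (conjugate_ne_bot hf.proper (us + (n : ℝ) • ys))
          (ne_top_of_le_ne_top (EReal.coe_ne_top _) ih)
        have h1 := hrec (us + (n : ℝ) • ys) (by simp [dom, hr])
        rw [hr, EReal.sub_le_iff_le_add (by simp) (by simp)] at h1
        rw [hr] at ih
        have ih' : r ≤ k + n * c := by exact_mod_cast ih
        have hstep : us + ((n + 1 : ℕ) : ℝ) • ys = us + (n : ℝ) • ys + ys := by
          push_cast
          rw [add_smul, one_smul, add_assoc]
        rw [hstep]
        refine h1.trans ?_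
        have : c + r ≤ k + (n + 1 : ℕ) * c := by
          push_cast
          linarith
        exact_mod_cast this
    by_contra! hlt
    obtain ⟨n, hn⟩ := exists_nat_gt ((k - us x + a) / (ys x - c))
    rw [div_lt_iff₀ (by linarith)] at hn
    have := (hle _ _).1 (hind n) x a ha
    simp only [add_apply, smul_apply, smul_eq_mul] at this
    linarith
  · intro hsup us hus
    obtain ⟨k, hk⟩ := exists_coe_eq (conjugate_ne_bot hf.proper us) (ne_of_lt hus)
    rw [hk, EReal.sub_le_iff_le_add (by simp) (by simp), ← EReal.coe_add, hle]
    intro x a ha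
    have h1 := (hle us k).1 hk.le x a ha
    have h2 := hsup x a ha
    rw [add_apply]
    linarith

/-! ### Scalings and perspectives -/

theorem scaling_of_pos {f : X → EReal} {ξ : ℝ} (hξ : 0 < ξ) (x : X) :
    scaling ξ f x = (ξ : EReal) * f x := if_neg hξ.ne'

theorem scaling_of_eq_coe {f : X → EReal} {x : X} {a : ℝ} (ha : f x = a) (ξ : ℝ) :
    scaling ξ f x = ((ξ * a : ℝ) : EReal) := by
  by_cases hξ : ξ = 0
  · have : x ∈ closure (dom f) := subset_closure (by simp [dom, ha])
    simp [scaling, hξ, indicator, this]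
  · rw [scaling, if_neg hξ, ha, EReal.coe_mul]

theorem scaling_isProper {f : X → EReal} (hf : IsProper f) {ξ : ℝ} (hξ : 0 ≤ ξ) :
    IsProper (scaling ξ f) := by
  constructor
  · intro x
    rcases hξ.eq_or_lt with rfl | hpos
    · by_cases hx : x ∈ closure (dom f) <;> simp [scaling, indicator, hx]
    · by_cases htop : f x = ⊤
      · rw [scaling_of_pos hpos, htop, EReal.coe_mul_top_of_pos hpos]
        exact top_ne_bot
      · obtain ⟨a, ha⟩ := exists_coe_eq (hf.1 x) htop
        rw [scaling_of_eq_coe ha]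
        exact EReal.coe_ne_bot _
  · obtain ⟨x, a, ha⟩ := hf.exists_coe
    exact ⟨x, by rw [scaling_of_eq_coe ha]; exact EReal.coe_ne_top _⟩

/-- For ξ = 0 the supremum runs over the closure of dom f, but a continuous functional has the same
upper bounds on a set and on its closure. -/
theorem conjugate_scaling_le_coe_iff {f : X → EReal} (hf : IsProper f) {ξ : ℝ} (hξ : 0 ≤ ξ)
    (xs : StrongDual ℝ X) (c : ℝ) :
    conjugate (scaling ξ f) xs ≤ c ↔ ∀ x, ∀ a : ℝ, f x = a → xs x - ξ * a ≤ c := by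
  rw [conjugate_le_coe_iff (scaling_isProper hf hξ).1]
  constructor
  · intro h x a ha
    exact h x _ (scaling_of_eq_coe ha ξ)
  · intro h x b hb
    rcases hξ.eq_or_lt with rfl | hpos
    · have hx : x ∈ closure (dom f) := by
        by_contra hx
        simp [scaling, indicator, hx] at hb
      have hb0 : b = 0 := by
        have : (0 : EReal) = b := by simpa [scaling, indicator, hx] using hb
        exact_mod_cast this.symm
      have hsub : closure (dom f) ⊆ {y | xs y ≤ c} := by
        refine closure_minimal (fun y hy => ?_) (isClosed_le xs.continuous continuous_const)
        obtain ⟨a, ha⟩ := exists_coe_eq (hf.1 y) (ne_of_lt hy)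
        simpa using h y a ha
      have := hsub hx
      rw [hb0, sub_zero]
      exact this
    · by_cases htop : f x = ⊤
      · rw [scaling_of_pos hpos, htop, EReal.coe_mul_top_of_pos hpos] at hb
        exact absurd hb (EReal.top_ne_coe _)
      · obtain ⟨a, ha⟩ := exists_coe_eq (hf.1 x) htop
        rw [scaling_of_eq_coe ha] at hb
        have hb' : ξ * a = b := by exact_mod_cast hb
        rw [← hb']
        exact h x a ha

/-- The perspective of the conjugate is the conjugate of the scaling. -/
theorem perspective_conjugate {f : X → EReal} (hf : IsGammaZero f) {ξ : ℝ} (hξ : 0 ≤ ξ)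
    (xs : StrongDual ℝ X) :
    perspective (conjugate f) (xs, ξ) = conjugate (scaling ξ f) xs := by
  refine eq_of_forall_le_coe_iff fun c => ?_
  rw [conjugate_scaling_le_coe_iff hf.proper hξ]
  rcases hξ.eq_or_lt with rfl | hpos
  · simp only [perspective, lt_irrefl, if_false, if_true, zero_mul, sub_zero]
    exact recession_conjugate_le_coe_iff hf xs c
  · have h1 : perspective (conjugate f) (xs, ξ) = (ξ : EReal) * conjugate f (ξ⁻¹ • xs) := by
      simp [perspective, hpos]
    rw [h1, mul_comm, ← EReal.le_div_iff_mul_le (by exact_mod_cast hpos) (EReal.coe_ne_top _),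
      ← EReal.coe_div, conjugate_le_coe_iff hf.proper.1]
    refine forall_congr' fun x => forall_congr' fun a => imp_congr_right fun _ => ?_
    rw [le_div_iff₀ hpos, smul_apply, smul_eq_mul, sub_mul, mul_right_comm,
      inv_mul_cancel₀ hpos.ne', one_mul, mul_comm a]

theorem perspective_of_neg {f : X → EReal} {ξ : ℝ} (hξ : ξ < 0) (x : X) :
    perspective f (x, ξ) = ⊤ := by
  simp [perspective, hξ.not_gt, hξ.ne]

end

/-! ### Increasing functions on the real line -/

theorem conjugateReal_le_coe_iff {φ : ℝ → EReal} (hbot : ∀ t, φ t ≠ ⊥) (ξ c : ℝ) :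
    conjugateReal φ ξ ≤ c ↔ ∀ t p : ℝ, φ t = p → ξ * t - p ≤ c := by
  simp [conjugateReal, conjugate_le_coe_iff hbot, realFunctional]

theorem conjugateReal_ne_bot {φ : ℝ → EReal} (hφ : IsProper φ) (ξ : ℝ) : conjugateReal φ ξ ≠ ⊥ :=
  conjugate_ne_bot hφ _

/-- As t → -∞, φ t stays below a fixed real value while ξ t → +∞. -/
theorem conjugateReal_of_neg {φ : ℝ → EReal} (hφ : IsProper φ) (hmono : Monotone φ) {ξ : ℝ}
    (hξ : ξ < 0) : conjugateReal φ ξ = ⊤ := by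
  rw [EReal.eq_top_iff_forall_lt]
  intro c
  by_contra! hle
  rw [conjugateReal_le_coe_iff hφ.1] at hle
  obtain ⟨t, p, hp⟩ := hφ.exists_coe
  -- Far enough left that ξ s ≥ c + p + 1, while monotonicity keeps φ s ≤ p.
  set s := min t ((c + p + 1) / ξ) with hs
  have hst : φ s ≤ p := hp ▸ hmono (min_le_left _ _)
  obtain ⟨q, hq⟩ := exists_coe_eq (hφ.1 s) (ne_top_of_le_ne_top (EReal.coe_ne_top _) hst)
  have h1 := hle s q hq
  rw [hq] at hst
  have h2 : q ≤ p := by exact_mod_cast hst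
  have h3 : c + p + 1 ≤ ξ * s := by
    rw [mul_comm, ← le_div_iff_of_neg hξ]
    exact min_le_right _ _
  linarith

/-- A nonconstant increasing function in `Γ₀(ℝ)` is unbounded above. -/
theorem IsGammaZero.exists_coe_lt {φ : ℝ → EReal} (hφ : IsGammaZero φ)
    (hconst : ¬ ∃ c : EReal, ∀ ξ : ℝ, φ ξ = c) (M : ℝ) : ∃ t, (M : EReal) < φ t := by
  by_contra! hM
  have hne : ∃ a b, φ a < φ b := by
    by_contra! hle
    exact hconst ⟨φ 0, fun ξ => le_antisymm (hle 0 ξ) (hle ξ 0)⟩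
  obtain ⟨a, b, hab⟩ := hne
  obtain ⟨r, har, hrb⟩ := EReal.lt_iff_exists_real_btwn.1 hab
  obtain ⟨α, hα⟩ := exists_coe_eq (hφ.proper.1 a) (ne_top_of_lt hab)
  have hαr : α < r := by
    rw [hα] at har
    exact_mod_cast har
  have hrM : r < M := by exact_mod_cast hrb.trans_le (hM b)
  -- If φ ≤ M, extend the segment from a through b to a + (b - a) / l. The weight l makes the chord
  -- from height α to height M pass b at height r, below φ b.
  set l := (r - α) / (M - α) with hl
  have hl0 : 0 < l := div_pos (by linarith) (by linarith)
  have hl1 : l ≤ 1 := by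
    rw [hl, div_le_one (by linarith)]
    linarith
  have hconv := le_combination_of_convex_epigraph hφ.convex (hα.le) (hM (a + (b - a) / l))
    (sub_nonneg.2 hl1) hl0.le (by ring)
  have hpt : (1 - l) • a + l • (a + (b - a) / l) = b := by
    simp only [smul_eq_mul]
    field_simp
    ring
  have hval : (1 - l) * α + l * M = r := by
    have : l * (M - α) = r - α := div_mul_cancel₀ _ (by linarith)
    linarith
  rw [hpt, hval] at hconv
  exact absurd hconv (not_le.2 hrb)

/-! ### The composition and its membership in Γ₀ -/

theorem composition_of_eq_coe {X : Type*} {φ : ℝ → EReal} {f : X → EReal} {x : X} {t : ℝ}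
    (ht : f x = t) : composition φ f x = φ t := by
  rw [composition, ht, EReal.toReal_coe]
  split_ifs with h
  · rfl
  · by_contra hne
    exact h ⟨t, lt_top_iff_ne_top.2 fun h' => hne h'.symm, rfl⟩

theorem composition_of_eq_top {X : Type*} {φ : ℝ → EReal} {f : X → EReal} {x : X}
    (hx : f x = ⊤) : composition φ f x = ⊤ := by
  rw [composition, if_neg]
  rintro ⟨t, -, ht⟩
  exact EReal.coe_ne_top t (ht.trans hx)

theorem dom_composition {X : Type*} (φ : ℝ → EReal) (f : X → EReal) :
    dom (composition φ f) = f ⁻¹' toERealSet (dom φ) := by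
  ext x
  constructor
  · intro h
    by_contra hx
    exact (ne_of_lt (show composition φ f x < ⊤ from h)) (if_neg hx)
  · rintro ⟨t, ht, htx⟩
    change composition φ f x < ⊤
    rw [composition_of_eq_coe htx.symm]
    exact ht

theorem composition_le_coe_iff {X : Type*} {φ : ℝ → EReal} {f : X → EReal} (hf : IsProper f) (x : X) (p : ℝ) :
    composition φ f x ≤ p ↔ ∃ t : ℝ, f x = t ∧ φ t ≤ p := by
  constructor
  · intro h
    by_cases htop : f x = ⊤
    · rw [composition_of_eq_top htop, top_le_iff] at h
      exact absurd h (EReal.coe_ne_top _)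
    · obtain ⟨t, ht⟩ := exists_coe_eq (hf.1 x) htop
      exact ⟨t, ht, composition_of_eq_coe (φ := φ) ht ▸ h⟩
  · rintro ⟨t, ht, hp⟩
    rwa [composition_of_eq_coe ht]

section

variable {X : Type*} [NormedAddCommGroup X] [NormedSpace ℝ X] {φ : ℝ → EReal} {f : X → EReal}

theorem composition_isGammaZero (hφ : IsGammaZero φ) (hmono : Monotone φ)
    (hconst : ¬ ∃ c : EReal, ∀ ξ : ℝ, φ ξ = c) (hf : IsGammaZero f)
    (hdom : (toERealSet (dom φ) ∩ f '' dom f).Nonempty) : IsGammaZero (composition φ f) := by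
  refine ⟨⟨fun x => ?_, ?_⟩, ?_, ?_⟩
  · rw [composition]
    split_ifs
    · exact hφ.proper.1 _
    · exact top_ne_bot
  · obtain ⟨_, ⟨t, ht, rfl⟩, ⟨x, -, hx⟩⟩ := hdom
    exact ⟨x, by rw [composition_of_eq_coe hx]; exact ne_of_lt ht⟩
  · intro x y hy
    -- A level s strictly below f x with y < φ s: semicontinuity of f keeps f z > s near x, and
    -- monotonicity finishes. If f x = +∞, s exists because φ is unbounded above; otherwise
    -- semicontinuity of φ allows a step to the left of f x.
    have hex : ∃ s : ℝ, (s : EReal) < f x ∧ y < φ s := by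
      by_cases htop : f x = ⊤
      · rw [composition_of_eq_top htop] at hy
        obtain ⟨M, hyM, -⟩ := EReal.lt_iff_exists_real_btwn.1 hy
        obtain ⟨s, hs⟩ := hφ.exists_coe_lt hconst M
        exact ⟨s, by rw [htop]; exact EReal.coe_lt_top s, hyM.trans hs⟩
      · obtain ⟨t, ht⟩ := exists_coe_eq (hf.proper.1 x) htop
        rw [composition_of_eq_coe ht] at hy
        have hev : ∀ᶠ s in 𝓝[<] t, y < φ s := (hφ.lsc t y hy).filter_mono nhdsWithin_le_nhds
        obtain ⟨s, hs, hst⟩ := (hev.and self_mem_nhdsWithin).exists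
        exact ⟨s, by rw [ht]; exact_mod_cast hst, hs⟩
    obtain ⟨s, hsx, hys⟩ := hex
    filter_upwards [hf.lsc x s hsx] with z hz
    by_cases htop : f z = ⊤
    · rw [composition_of_eq_top htop]
      exact hys.trans_le le_top
    · obtain ⟨t, ht⟩ := exists_coe_eq (hf.proper.1 z) htop
      rw [composition_of_eq_coe ht]
      rw [ht] at hz
      exact hys.trans_le (hmono (by exact_mod_cast hz.le))
  · rintro ⟨x, p⟩ hx ⟨y, q⟩ hy a b ha hb hab
    obtain ⟨s, hs, hsp⟩ := (composition_le_coe_iff hf.proper x p).1 hx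
    obtain ⟨t, ht, htq⟩ := (composition_le_coe_iff hf.proper y q).1 hy
    have h1 := le_combination_of_convex_epigraph hf.convex hs.le ht.le ha hb hab
    have h2 := le_combination_of_convex_epigraph hφ.convex hsp htq ha hb hab
    obtain ⟨r, hr⟩ := exists_coe_eq (hf.proper.1 (a • x + b • y))
      (ne_top_of_le_ne_top (EReal.coe_ne_top _) h1)
    rw [hr] at h1
    exact (composition_le_coe_iff hf.proper _ _).2
      ⟨r, hr, (hmono (by exact_mod_cast h1)).trans h2⟩

/-! ### Duality for the conjugate of the composition -/

theorem conjugate_composition_le_coe_iff (hφ : IsProper φ) (hf : IsProper f)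
    (xs : StrongDual ℝ X) (m : ℝ) :
    conjugate (composition φ f) xs ≤ m ↔
      ∀ x, ∀ t p : ℝ, f x = t → φ t = p → xs x - p ≤ m := by
  have hbot : ∀ x, composition φ f x ≠ ⊥ := by
    intro x
    rw [composition]
    split_ifs
    · exact hφ.1 _
    · exact top_ne_bot
  rw [conjugate_le_coe_iff hbot]
  constructor
  · intro h x t p ht hp
    exact h x p ((composition_of_eq_coe ht).trans hp)
  · intro h x p hp
    obtain ⟨t, ht, -⟩ := (composition_le_coe_iff hf x p).1 hp.le
    exact h x t p ht ((composition_of_eq_coe ht).symm.trans hp)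

/-- Weak duality. -/
theorem conjugate_composition_le (hφ : IsProper φ) (hf : IsProper f) {ξ : ℝ} (hξ : 0 ≤ ξ)
    (xs : StrongDual ℝ X) :
    conjugate (composition φ f) xs ≤ conjugateReal φ ξ + conjugate (scaling ξ f) xs := by
  by_cases h1 : conjugateReal φ ξ = ⊤
  · rw [h1, EReal.top_add_of_ne_bot (conjugate_ne_bot (scaling_isProper hf hξ) xs)]
    exact le_top
  by_cases h2 : conjugate (scaling ξ f) xs = ⊤
  · rw [h2, EReal.add_top_of_ne_bot (conjugateReal_ne_bot hφ _)]
    exact le_top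
  obtain ⟨c, hc⟩ := exists_coe_eq (conjugateReal_ne_bot hφ ξ) h1
  obtain ⟨d, hd⟩ := exists_coe_eq (conjugate_ne_bot (scaling_isProper hf hξ) xs) h2
  rw [hc, hd, ← EReal.coe_add, conjugate_composition_le_coe_iff hφ hf]
  intro x t p ht hp
  have h3 := (conjugateReal_le_coe_iff hφ.1 ξ c).1 hc.le t p hp
  have h4 := (conjugate_scaling_le_coe_iff hf hξ xs d).1 hd.le x t ht
  linarith

/-- Existence of a Lagrange multiplier: the slope at the origin of an affine minorant of the value
function `s ↦ inf_x (φ (f x + s) - ⟨x, xs⟩)`. -/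
theorem exists_multiplier (hφ : IsGammaZero φ) (hmono : Monotone φ) (hf : IsGammaZero f)
    {z : X} (hz : f z ∈ toERealSet (interior (dom φ))) {xs : StrongDual ℝ X} {m : ℝ}
    (hm : conjugate (composition φ f) xs ≤ m) :
    ∃ ξ : ℝ, ∀ x, ∀ a t p : ℝ, f x = a → φ t = p → ξ * (t - a) ≤ p - xs x + m := by
  rw [conjugate_composition_le_coe_iff hφ.proper hf.proper] at hm
  obtain ⟨t₀, ht₀, hzt⟩ := hz
  obtain ⟨ε, hε, hball⟩ := Metric.isOpen_iff.1 isOpen_interior t₀ ht₀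
  have hreal : ∀ t, |t - t₀| < ε → ∃ p : ℝ, φ t = p := fun t ht =>
    exists_coe_eq (hφ.proper.1 t) (ne_of_lt (show φ t < ⊤ from interior_subset (s := dom φ) (hball (by
      rwa [Metric.mem_ball, Real.dist_eq]))))
  obtain ⟨p₁, hp₁⟩ := hreal (t₀ - ε / 2) (by rw [abs_lt]; constructor <;> linarith)
  obtain ⟨p₂, hp₂⟩ := hreal (t₀ + ε / 2) (by rw [abs_lt]; constructor <;> linarith)
  -- Slopes at perturbations s - a < 0 lie below slopes at perturbations t - b > 0. The weights l
  -- and k cancel the two perturbations, so the convex combination is feasible for perturbation 0,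
  -- where `hm` applies; monotonicity of φ absorbs the Jensen gap of f.
  have hcross : ∀ x y, ∀ a b s t p q : ℝ, f x = a → f y = b → φ s = p → φ t = q → s < a → b < t →
      (p - xs x + m) / (s - a) ≤ (q - xs y + m) / (t - b) := by
    intro x y a b s t p q hx hy hs ht hsa hbt
    have hD : 0 < (t - b) + (a - s) := by linarith
    set l := (t - b) / ((t - b) + (a - s)) with hl
    set k := (a - s) / ((t - b) + (a - s)) with hk
    have hl0 : 0 ≤ l := div_nonneg (by linarith) hD.le
    have hk0 : 0 ≤ k := div_nonneg (by linarith) hD.le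
    have hlk : l + k = 1 := by
      rw [hl, hk, ← add_div, div_self hD.ne']
    have h1 := le_combination_of_convex_epigraph hf.convex hx.le hy.le hl0 hk0 hlk
    have h2 := le_combination_of_convex_epigraph hφ.convex hs.le ht.le hl0 hk0 hlk
    have hbal : l * a + k * b = l * s + k * t := by
      rw [hl, hk]
      field_simp
      ring
    obtain ⟨r, hr⟩ := exists_coe_eq (hf.proper.1 (l • x + k • y))
      (ne_top_of_le_ne_top (EReal.coe_ne_top _) h1)
    rw [hr, hbal] at h1
    have h3 : φ r ≤ ((l * p + k * q : ℝ) : EReal) :=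
      (hmono (by exact_mod_cast h1)).trans h2
    obtain ⟨v, hv⟩ := exists_coe_eq (hφ.proper.1 r)
      (ne_top_of_le_ne_top (EReal.coe_ne_top _) h3)
    rw [hv] at h3
    have h4 : v ≤ l * p + k * q := by exact_mod_cast h3
    have h5 := hm _ r v hr hv
    rw [map_add, map_smul, map_smul, smul_eq_mul, smul_eq_mul] at h5
    have h6 : 0 ≤ l * (p - xs x + m) + k * (q - xs y + m) := by
      have : l * m + k * m = m := by rw [← add_mul, hlk, one_mul]
      linarith
    have h7 : 0 ≤ (t - b) * (p - xs x + m) + (a - s) * (q - xs y + m) := by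
      have := mul_nonneg hD.le h6
      have e1 : ((t - b) + (a - s)) * l = t - b := mul_div_cancel₀ _ hD.ne'
      have e2 : ((t - b) + (a - s)) * k = a - s := mul_div_cancel₀ _ hD.ne'
      rwa [mul_add, ← mul_assoc, ← mul_assoc, e1, e2] at this
    rw [div_le_iff_of_neg (by linarith), div_mul_eq_mul_div, div_le_iff₀ (by linarith)]
    linarith
  -- The multiplier is the supremum of the left slopes. Interiority of t₀ provides one left slope
  -- and one right slope at z, so S is nonempty and bounded above.
  set S : Set ℝ := {q | ∃ x, ∃ a t p : ℝ, f x = a ∧ φ t = p ∧ t < a ∧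
    q = (p - xs x + m) / (t - a)} with hS
  have hne : S.Nonempty := ⟨_, z, t₀, t₀ - ε / 2, p₁, hzt.symm, hp₁, by linarith, rfl⟩
  have hub : ∀ x, ∀ a t p : ℝ, f x = a → φ t = p → a < t →
      (p - xs x + m) / (t - a) ∈ upperBounds S := by
    rintro y b t q hy ht hbt _ ⟨x, a, s, p, hx, hs, hsa, rfl⟩
    exact hcross x y a b s t p q hx hy hs ht hsa hbt
  have hbdd : BddAbove S := ⟨_, hub z t₀ (t₀ + ε / 2) p₂ hzt.symm hp₂ (by linarith)⟩
  refine ⟨sSup S, fun x a t p hx ht => ?_⟩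
  rcases lt_trichotomy t a with hlt | rfl | hgt
  · have := le_csSup hbdd ⟨x, a, t, p, hx, ht, hlt, rfl⟩
    rwa [div_le_iff_of_neg (by linarith)] at this
  · have := hm x t p hx ht
    rw [sub_self, mul_zero]
    linarith
  · have := csSup_le hne (hub x a t p hx ht hgt)
    rwa [le_div_iff₀ (by linarith)] at this

/-- Strong duality: the conjugate of the composition, with attainment of the minimum. -/
theorem isLeast_conjugate_composition (hφ : IsGammaZero φ) (hmono : Monotone φ)
    (hf : IsGammaZero f) {z : X} (hz : f z ∈ toERealSet (interior (dom φ)))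
    (xs : StrongDual ℝ X) :
    IsLeast (range fun ξs : ℝ => conjugateReal φ ξs + perspective (conjugate f) (xs, ξs))
      (conjugate (composition φ f) xs) := by
  have hlower : ∀ ξ : ℝ, conjugate (composition φ f) xs ≤
      conjugateReal φ ξ + perspective (conjugate f) (xs, ξ) := by
    intro ξ
    rcases lt_or_ge ξ 0 with hξ | hξ
    · rw [perspective_of_neg hξ, EReal.add_top_of_ne_bot (conjugateReal_ne_bot hφ.proper _)]
      exact le_top
    · rw [perspective_conjugate hf hξ]
      exact conjugate_composition_le hφ.proper hf.proper hξ xs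
  refine ⟨?_, by rintro _ ⟨ξ, rfl⟩; exact hlower ξ⟩
  by_cases htop : conjugate (composition φ f) xs = ⊤
  · exact ⟨0, by rw [htop]; exact top_le_iff.1 (htop ▸ hlower 0)⟩
  obtain ⟨t₀, ht₀, hzt⟩ := id hz
  obtain ⟨p₀, hp₀⟩ := exists_coe_eq (hφ.proper.1 t₀) (ne_of_lt (show φ t₀ < ⊤ from interior_subset (s := dom φ) ht₀))
  have hbot : conjugate (composition φ f) xs ≠ ⊥ := by
    intro h
    have := (conjugate_composition_le_coe_iff hφ.proper hf.proper xs (xs z - p₀ - 1)).1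
      (by simp [h]) z t₀ p₀ hzt.symm hp₀
    linarith
  obtain ⟨m, hm⟩ := exists_coe_eq hbot htop
  obtain ⟨ξ, hξ⟩ := exists_multiplier hφ hmono hf hz hm.le
  -- Supremum over the argument of φ with x fixed; the supremum over x is taken below, once φ*(ξ) is
  -- known to be real.
  have hφle : ∀ x, ∀ a : ℝ, f x = a →
      conjugateReal φ ξ ≤ ((m - (xs x - ξ * a) : ℝ) : EReal) := by
    intro x a ha
    rw [conjugateReal_le_coe_iff hφ.proper.1]
    intro t p hp
    have := hξ x a t p ha hp
    linarith
  have hξ0 : 0 ≤ ξ := by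
    by_contra! hneg
    have := hφle z t₀ hzt.symm
    rw [conjugateReal_of_neg hφ.proper hmono hneg, top_le_iff] at this
    exact EReal.coe_ne_top _ this
  obtain ⟨c, hc⟩ : ∃ c : ℝ, conjugateReal φ ξ = c :=
    exists_coe_eq (conjugate_ne_bot hφ.proper _)
      (ne_top_of_le_ne_top (EReal.coe_ne_top _) (hφle z t₀ hzt.symm))
  refine ⟨ξ, le_antisymm ?_ (hlower ξ)⟩
  have hle : conjugate (scaling ξ f) xs ≤ ((m - c : ℝ) : EReal) := by
    rw [conjugate_scaling_le_coe_iff hf.proper hξ0]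
    intro x a ha
    have := hφle x a ha
    rw [hc] at this
    have : c ≤ m - (xs x - ξ * a) := by exact_mod_cast this
    linarith
  calc conjugateReal φ ξ + perspective (conjugate f) (xs, ξ)
      ≤ (c : EReal) + ((m - c : ℝ) : EReal) := by
        rw [perspective_conjugate hf hξ0]
        exact add_le_add hc.le hle
    _ = conjugate (composition φ f) xs := by
        rw [hm, ← EReal.coe_add, add_sub_cancel]

/-! ### Equality cases and subgradients -/

theorem ne_top_of_add_eq_coe {a b : EReal} {r : ℝ} (ha : a ≠ ⊥) (hb : b ≠ ⊥) (h : a + b = r) :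
    a ≠ ⊤ ∧ b ≠ ⊤ := by
  constructor
  · rintro rfl
    rw [EReal.top_add_of_ne_bot hb] at h
    exact EReal.top_ne_coe _ h
  · rintro rfl
    rw [EReal.add_top_of_ne_bot ha] at h
    exact EReal.top_ne_coe _ h

theorem coe_le_add_conjugate {h : X → EReal} (hh : IsProper h) (x : X) (xs : StrongDual ℝ X) :
    ((xs x : ℝ) : EReal) ≤ h x + conjugate h xs := by
  by_cases h1 : h x = ⊤
  · rw [h1, EReal.top_add_of_ne_bot (conjugate_ne_bot hh xs)]
    exact le_top
  by_cases h2 : conjugate h xs = ⊤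
  · rw [h2, EReal.add_top_of_ne_bot (hh.1 x)]
    exact le_top
  obtain ⟨a, ha⟩ := exists_coe_eq (hh.1 x) h1
  obtain ⟨c, hc⟩ := exists_coe_eq (conjugate_ne_bot hh xs) h2
  have := (conjugate_le_coe_iff hh.1 xs c).1 hc.le x a ha
  rw [ha, hc]
  have : xs x ≤ a + c := by linarith
  exact_mod_cast this

/-- The middle equality is the tight sum of Fenchel-Young for φ and for ξ⋄f, hence both are tight.
It also squeezes Fenchel-Young for φ∘f against weak duality, giving the third system. For ξ < 0 the
middle equality fails since φ*(ξ) = +∞. -/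
theorem tfae_conjugate_composition (hφ : IsProper φ) (hmono : Monotone φ) (hf : IsProper f)
    (hcomp : IsProper (composition φ f)) {x : X} (hx : x ∈ dom f) (xs : StrongDual ℝ X) (ξ : ℝ) :
    List.TFAE [
      composition φ f x + conjugateReal φ ξ = scaling ξ f x ∧
        scaling ξ f x + conjugate (scaling ξ f) xs = ((xs x : ℝ) : EReal),
      composition φ f x + conjugateReal φ ξ + conjugate (scaling ξ f) xs = ((xs x : ℝ) : EReal),
      composition φ f x + conjugate (composition φ f) xs = ((xs x : ℝ) : EReal) ∧
        conjugateReal φ ξ + conjugate (scaling ξ f) xs = conjugate (composition φ f) xs] := by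
  obtain ⟨t, ht⟩ := exists_coe_eq (hf.1 x) (ne_of_lt hx)
  have hsc := scaling_of_eq_coe ht ξ
  have hφb : conjugateReal φ ξ ≠ ⊥ := conjugate_ne_bot hφ _
  tfae_have 1 → 2 := fun ⟨h1, h2⟩ => by rw [h1, h2]
  tfae_have 3 → 2 := fun ⟨h1, h2⟩ => by rw [add_assoc, h2, h1]
  tfae_have 2 → 1 := fun h => by
    rcases lt_or_ge ξ 0 with hξ | hξ
    · rw [conjugateReal_of_neg hφ hmono hξ, EReal.add_top_of_ne_bot (hcomp.1 x)] at h
      exact absurd h (top_add_ne_coe _ _)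
    have hsb := conjugate_ne_bot (scaling_isProper hf hξ) xs
    obtain ⟨h1, h2⟩ := ne_top_of_add_eq_coe (by simp [EReal.add_eq_bot_iff, hcomp.1 x, hφb]) hsb h
    obtain ⟨u, hu⟩ := exists_coe_eq (by simp [EReal.add_eq_bot_iff, hcomp.1 x, hφb]) h1
    obtain ⟨d, hd⟩ := exists_coe_eq hsb h2
    have h3 : ((ξ * t : ℝ) : EReal) ≤ composition φ f x + conjugateReal φ ξ := by
      have := coe_le_add_conjugate hφ t (realFunctional ξ)
      rw [composition_of_eq_coe ht]
      simpa [realFunctional, conjugateReal] using this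
    have h4 := coe_le_add_conjugate (scaling_isProper hf hξ) x xs
    rw [hu] at h3 h ⊢
    rw [hd] at h h4 ⊢
    rw [hsc] at h4 ⊢
    norm_cast at h h3 h4 ⊢
    constructor <;> linarith
  tfae_have 2 → 3 := fun h => by
    rcases lt_or_ge ξ 0 with hξ | hξ
    · rw [conjugateReal_of_neg hφ hmono hξ, EReal.add_top_of_ne_bot (hcomp.1 x)] at h
      exact absurd h (top_add_ne_coe _ _)
    have h0 := conjugate_composition_le hφ hf hξ xs
    have hsb := conjugate_ne_bot (scaling_isProper hf hξ) xs
    rw [add_assoc] at h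
    have hsum : conjugateReal φ ξ + conjugate (scaling ξ f) xs ≠ ⊥ := by
      simp [EReal.add_eq_bot_iff, hφb, hsb]
    obtain ⟨h1, h2⟩ := ne_top_of_add_eq_coe (hcomp.1 x) hsum h
    have h3 := coe_le_add_conjugate hcomp x xs
    obtain ⟨p, hp⟩ := exists_coe_eq (hcomp.1 x) h1
    obtain ⟨d, hd⟩ := exists_coe_eq hsum h2
    obtain ⟨c, hc⟩ := exists_coe_eq (conjugate_ne_bot hcomp xs) (ne_top_of_le_ne_top h2 h0)
    rw [hd] at h h0 ⊢
    rw [hc] at h0 h3 ⊢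
    rw [hp] at h h3 ⊢
    norm_cast at h h0 h3 ⊢
    constructor <;> linarith
  tfae_finish

/-- Subgradients of `φ` and of the scaled function, in terms of the conjugates. -/
theorem mem_subdifferentialReal_and_iff (hφ : IsProper φ) (hmono : Monotone φ) (hf : IsProper f)
    (hcomp : IsProper (composition φ f)) {x : X} (hx : x ∈ dom f) (xs : StrongDual ℝ X) (ξ : ℝ) :
    (ξ ∈ subdifferentialReal φ (f x).toReal ∧ xs ∈ subdifferential (scaling ξ f) x) ↔
      (composition φ f x + conjugate (composition φ f) xs = ((xs x : ℝ) : EReal) ∧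
        conjugateReal φ ξ + conjugate (scaling ξ f) xs = conjugate (composition φ f) xs) := by
  obtain ⟨t, ht⟩ := exists_coe_eq (hf.1 x) (ne_of_lt hx)
  have hφiff : ξ ∈ subdifferentialReal φ (f x).toReal ↔
      composition φ f x + conjugateReal φ ξ = scaling ξ f x := by
    rw [scaling_of_eq_coe ht, composition_of_eq_coe ht, ht, EReal.toReal_coe]
    have := mem_subdifferential_iff hφ t (realFunctional ξ)
    rwa [show realFunctional ξ t = ξ * t from by simp [realFunctional]] at this
  refine Iff.trans ?_ ((tfae_conjugate_composition hφ hmono hf hcomp hx xs ξ).out 0 2)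
  rw [hφiff]
  refine and_congr_right fun h => ?_
  have hξ : 0 ≤ ξ := by
    by_contra! hneg
    rw [conjugateReal_of_neg hφ hmono hneg, EReal.add_top_of_ne_bot (hcomp.1 x),
      scaling_of_eq_coe ht] at h
    exact EReal.top_ne_coe _ h
  exact mem_subdifferential_iff (scaling_isProper hf hξ) x xs

/-- Subgradients of the composition and multipliers, in terms of the conjugates. -/
theorem mem_subdifferential_composition_and_argmin_iff (hφ : IsGammaZero φ) (hmono : Monotone φ)
    (hf : IsGammaZero f) (hcomp : IsProper (composition φ f)) {z : X}
    (hz : f z ∈ toERealSet (interior (dom φ))) (x : X) (xs : StrongDual ℝ X) (ξ : ℝ) :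
    (xs ∈ subdifferential (composition φ f) x ∧
        ξ ∈ argmin fun η : ℝ => conjugateReal φ η + perspective (conjugate f) (xs, η)) ↔
      (composition φ f x + conjugate (composition φ f) xs = ((xs x : ℝ) : EReal) ∧
        conjugateReal φ ξ + conjugate (scaling ξ f) xs = conjugate (composition φ f) xs) := by
  rw [mem_subdifferential_iff hcomp]
  refine and_congr_right fun h => ?_
  have hne := (ne_top_of_add_eq_coe (hcomp.1 x) (conjugate_ne_bot hcomp xs) h).2
  obtain ⟨⟨η, hη⟩, hlow⟩ := isLeast_conjugate_composition hφ hmono hf hz xs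
  have hφb : ∀ ζ, conjugateReal φ ζ ≠ ⊥ := fun ζ => conjugate_ne_bot hφ.proper _
  rcases lt_or_ge ξ 0 with hξ | hξ
  · refine iff_of_false (fun hmem => ?_) (fun heq => ?_)
    -- For ξ < 0 the objective is +∞, and `argmin` requires membership in the domain.
    · have := hmem.1
      simp [dom, perspective_of_neg hξ, EReal.add_top_of_ne_bot (hφb ξ)] at this
    · obtain ⟨c, hc⟩ := exists_coe_eq (conjugate_ne_bot hcomp xs) hne
      rw [conjugateReal_of_neg hφ.proper hmono hξ, hc] at heq
      exact top_add_ne_coe _ _ heq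
  · rw [← perspective_conjugate hf hξ]
    constructor
    · intro hmem
      exact le_antisymm ((hmem.2 η).trans hη.le) (hlow ⟨ξ, rfl⟩)
    · intro heq
      refine ⟨?_, fun ζ => ?_⟩
      · simp only [dom, mem_ofPred_eq, heq]
        exact lt_top_iff_ne_top.2 hne
      · simp only [heq]
        exact hlow ⟨ζ, rfl⟩

end

end NonlinComp

theorem proposition2p8 {X : Type*} [NormedAddCommGroup X] [NormedSpace ℝ X] [CompleteSpace X]
    (hX : NonlinComp.IsReflexive X)
    (φ : ℝ → EReal) (hφ : NonlinComp.IsGammaZero φ) (hφmono : Monotone φ)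
    (hφconst : ¬ ∃ c : EReal, ∀ ξ : ℝ, φ ξ = c)
    (f : X → EReal) (hf : NonlinComp.IsGammaZero f)
    (hdom : (NonlinComp.toERealSet (NonlinComp.dom φ) ∩ f '' NonlinComp.dom f).Nonempty) :
    -- the domain of the composition
    NonlinComp.dom (NonlinComp.composition φ f)
        = f ⁻¹' NonlinComp.toERealSet (NonlinComp.dom φ) ∧
    -- the composition is proper, lower semicontinuous and convex
    NonlinComp.IsGammaZero (NonlinComp.composition φ f) ∧
    -- the conjugate of the composition; the minimum is attained
    ((∃ z : X, f z ∈ NonlinComp.toERealSet (interior (NonlinComp.dom φ))) →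
      ∀ xs : StrongDual ℝ X,
        IsLeast
          (Set.range fun ξs : ℝ =>
            NonlinComp.conjugateReal φ ξs
              + NonlinComp.perspective (NonlinComp.conjugate f) (xs, ξs))
          (NonlinComp.conjugate (NonlinComp.composition φ f) xs)) ∧
    -- the inclusion for subdifferentials, without qualification condition
    (∀ x ∈ NonlinComp.dom f,
      (⋃ ξs ∈ NonlinComp.subdifferentialReal φ (f x).toReal,
          NonlinComp.subdifferential (NonlinComp.scaling ξs f) x)
        ⊆ NonlinComp.subdifferential (NonlinComp.composition φ f) x) ∧
    -- the equality for subdifferentials, under the qualification condition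
    ((∃ z ∈ NonlinComp.dom f, f z ∈ NonlinComp.toERealSet (interior (NonlinComp.dom φ))) →
      ∀ x ∈ NonlinComp.dom f,
        NonlinComp.subdifferential (NonlinComp.composition φ f) x
          = ⋃ ξs ∈ NonlinComp.subdifferentialReal φ (f x).toReal,
              NonlinComp.subdifferential (NonlinComp.scaling ξs f) x) ∧
    -- three equivalent systems of equalities
    ((∃ z ∈ NonlinComp.dom f, f z ∈ NonlinComp.toERealSet (interior (NonlinComp.dom φ))) →
      ∀ x ∈ NonlinComp.dom f, ∀ (xs : StrongDual ℝ X) (ξs : ℝ),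
        List.TFAE [
          NonlinComp.composition φ f x + NonlinComp.conjugateReal φ ξs
              = NonlinComp.scaling ξs f x ∧
            NonlinComp.scaling ξs f x + NonlinComp.conjugate (NonlinComp.scaling ξs f) xs
              = ((xs x : ℝ) : EReal),
          NonlinComp.composition φ f x + NonlinComp.conjugateReal φ ξs
              + NonlinComp.conjugate (NonlinComp.scaling ξs f) xs
            = ((xs x : ℝ) : EReal),
          NonlinComp.composition φ f x
                + NonlinComp.conjugate (NonlinComp.composition φ f) xs
              = ((xs x : ℝ) : EReal) ∧
            NonlinComp.conjugateReal φ ξs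
                + NonlinComp.conjugate (NonlinComp.scaling ξs f) xs
              = NonlinComp.conjugate (NonlinComp.composition φ f) xs]) ∧
    -- the characterization of the pairs of subgradients
    ((∃ z ∈ NonlinComp.dom f, f z ∈ NonlinComp.toERealSet (interior (NonlinComp.dom φ))) →
      ∀ x ∈ NonlinComp.dom f, ∀ (xs : StrongDual ℝ X) (ξs : ℝ),
        (ξs ∈ NonlinComp.subdifferentialReal φ (f x).toReal ∧
            xs ∈ NonlinComp.subdifferential (NonlinComp.scaling ξs f) x) ↔
          (xs ∈ NonlinComp.subdifferential (NonlinComp.composition φ f) x ∧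
            ξs ∈ NonlinComp.argmin (fun ηs : ℝ =>
              NonlinComp.conjugateReal φ ηs
                + NonlinComp.perspective (NonlinComp.conjugate f) (xs, ηs)))) := by
  have hcomp : NonlinComp.IsGammaZero (NonlinComp.composition φ f) :=
    NonlinComp.composition_isGammaZero hφ hφmono hφconst hf hdom
  have hpair := fun x hx xs ξs => NonlinComp.mem_subdifferentialReal_and_iff (x := x)
    hφ.proper hφmono hf.proper hcomp.proper hx xs ξs
  have hincl : ∀ x ∈ NonlinComp.dom f,
      (⋃ ξs ∈ NonlinComp.subdifferentialReal φ (f x).toReal,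
          NonlinComp.subdifferential (NonlinComp.scaling ξs f) x)
        ⊆ NonlinComp.subdifferential (NonlinComp.composition φ f) x := by
    intro x hx xs hxs
    obtain ⟨ξs, hξs, hmem⟩ := Set.mem_iUnion₂.1 hxs
    exact (NonlinComp.mem_subdifferential_iff hcomp.proper x xs).2
      ((hpair x hx xs ξs).1 ⟨hξs, hmem⟩).1
  refine ⟨NonlinComp.dom_composition φ f, hcomp, ?_, hincl, ?_, ?_, ?_⟩
  · rintro ⟨z, hz⟩ xs
    exact NonlinComp.isLeast_conjugate_composition hφ hφmono hf hz xs
  · rintro ⟨z, -, hz⟩ x hx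
    refine Set.Subset.antisymm (fun xs hxs => ?_) (hincl x hx)
    obtain ⟨⟨ξs, hξs⟩, hlow⟩ := NonlinComp.isLeast_conjugate_composition hφ hφmono hf hz xs
    -- A subgradient makes (φ∘f)*(xs) finite, so the point attaining the minimum lies in the domain
    -- required by `argmin`.
    have hfin := (NonlinComp.ne_top_of_add_eq_coe (hcomp.proper.1 x)
      (NonlinComp.conjugate_ne_bot hcomp.proper xs)
      ((NonlinComp.mem_subdifferential_iff hcomp.proper x xs).1 hxs)).2
    have harg : ξs ∈ NonlinComp.argmin (fun ηs : ℝ => NonlinComp.conjugateReal φ ηs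
        + NonlinComp.perspective (NonlinComp.conjugate f) (xs, ηs)) :=
      ⟨hξs.trans_lt (lt_top_iff_ne_top.2 hfin), fun ηs => hξs.trans_le (hlow ⟨ηs, rfl⟩)⟩
    have hmem := (hpair x hx xs ξs).2
      ((NonlinComp.mem_subdifferential_composition_and_argmin_iff hφ hφmono hf hcomp.proper hz
        x xs ξs).1 ⟨hxs, harg⟩)
    exact Set.mem_iUnion₂.2 ⟨ξs, hmem.1, hmem.2⟩
  · rintro - x hx xs ξs
    exact NonlinComp.tfae_conjugate_composition hφ.proper hφmono hf.proper hcomp.proper hx xs ξs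
  · rintro ⟨z, -, hz⟩ x hx xs ξs
    exact (hpair x hx xs ξs).trans
      (NonlinComp.mem_subdifferential_composition_and_argmin_iff hφ hφmono hf hcomp.proper hz
        x xs ξs).symm
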